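/- Let $\mathbb{RP}^1$ be the real projective line, with affine coordinate $x\mapsto[x:1]$ and $\infty=[1:0]$, and let $\Omega\mathbb{RP}^1$ be the space of continuous maps $f:\mathbb{RP}^1\to\mathbb{RP}^1$ with $f(\infty)=[1:1]$, with the compact-open topology. For an integer $n\ge 0$ let $\mathrm{RRat}_n(1)\subset\Omega\mathbb{RP}^1$ be the set of maps of the form $[x:1]\mapsto[p(x):q(x)]$, where $p,q\in\mathbb{R}[x]$ are monic polynomials of degree $n$ without common complex roots, and let $\mathrm{rat}_n(1)$ be the closure of $\mathrm{RRat}_n(1)$ in $\Omega\mathbb{RP}^1$ (the space of real rational maps $\mathbb{RP}^1\to\mathbb{RP}^1$). **Theorem.** For every integer $n\ge0$, the space $\mathrm{rat}_n(1)$ has exactly $n+1$ connected components. They are indexed by the topological degree: the topological degree of a map is constant on each component, and it induces a bijection from the set of connected components of $\mathrm{rat}_n(1)$ onto the set of integers $d$ with $-n\le d\le n$ and $d\equiv n\pmod 2$. Every connected component is contractible. -/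

import Mathlib

open scoped Polynomial

/-- The real projective line: lines through the origin in `ℝ²`. -/
abbrev RP1 : Type := Projectivization ℝ (Fin 2 → ℝ)

/-- The quotient topology coming from `ℝ² ∖ {0}`. -/
noncomputable instance instTopologicalSpaceRP1 : TopologicalSpace RP1 :=
  TopologicalSpace.coinduced
    (fun v : {v : Fin 2 → ℝ // v ≠ 0} => Projectivization.mk ℝ v.1 v.2) inferInstance

namespace RP1

theorem vec_one_right_ne_zero (x : ℝ) : (![x, 1] : Fin 2 → ℝ) ≠ 0 := by
  intro h
  simpa using congrFun h 1

theorem vec_one_left_ne_zero (x : ℝ) : (![1, x] : Fin 2 → ℝ) ≠ 0 := by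
  intro h
  simpa using congrFun h 0

theorem vec_cos_sin_ne_zero (t : ℝ) : (![Real.cos t, Real.sin t] : Fin 2 → ℝ) ≠ 0 := by
  intro h
  have h0 : Real.cos t = 0 := by simpa using congrFun h 0
  have h1 : Real.sin t = 0 := by simpa using congrFun h 1
  have := Real.sin_sq_add_cos_sq t
  simp [h0, h1] at this

/-- The point `[x : 1]` of the affine piece, with affine coordinate `x`. -/
noncomputable def affine (x : ℝ) : RP1 := Projectivization.mk ℝ ![x, 1] (vec_one_right_ne_zero x)

/-- The point at infinity `[1 : 0]`, the basepoint of the source. -/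
noncomputable def infty : RP1 := Projectivization.mk ℝ ![1, 0] (vec_one_left_ne_zero 0)

/-- The point `[1 : 1]`, the basepoint of the target. -/
noncomputable def base : RP1 := Projectivization.mk ℝ ![1, 1] (vec_one_left_ne_zero 1)

/-- The universal covering `ℝ → ℝP¹`, `θ ↦ [cos πθ : sin πθ]`, whose deck transformations are the
integer translations. -/
noncomputable def cover (θ : ℝ) : RP1 :=
  Projectivization.mk ℝ ![Real.cos (Real.pi * θ), Real.sin (Real.pi * θ)] (vec_cos_sin_ne_zero _)

/-- `f : ℝP¹ → ℝP¹` has topological degree `d`: it has a continuous lift `F` to the universal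
covering with `F (θ + 1) = F θ + d`. -/
def HasDegree (f : C(RP1, RP1)) (d : ℤ) : Prop :=
  ∃ F : ℝ → ℝ, Continuous F ∧ (∀ θ, f (cover θ) = cover (F θ)) ∧ ∀ θ, F (θ + 1) = F θ + d

end RP1

/-- `Ω ℝP¹`: continuous maps `ℝP¹ → ℝP¹` sending `∞` to `[1 : 1]`, with the topology induced by the
compact-open topology. -/
abbrev LoopRP1 : Type := {f : C(RP1, RP1) // f RP1.infty = RP1.base}

/-- The image in `Ω ℝP¹` of the basepoint-preserving, conjugation-equivariant rational maps
`ℂP¹ → ℂP¹` of degree exactly `n`. Such a map is `[p : q]` for a unique pair of monic real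
polynomials of degree `n` without common complex roots. -/
def realRat (n : ℕ) : Set LoopRP1 :=
  {f | ∃ p q : ℝ[X], p.Monic ∧ q.Monic ∧ p.natDegree = n ∧ q.natDegree = n ∧ IsCoprime p q ∧
    ∀ x : ℝ, ∃ h : (![p.eval x, q.eval x] : Fin 2 → ℝ) ≠ 0,
      f.1 (RP1.affine x) = Projectivization.mk ℝ ![p.eval x, q.eval x] h}

/-- The space of real rational maps `ℝP¹ → ℝP¹`: the closure of `realRat n` in `Ω ℝP¹`. -/
def ratClosure (n : ℕ) : Set LoopRP1 := closure (realRat n)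

/-! The map (v₀ + i v₁)/(v₀ - i v₁) identifies the projective line with the unit circle. Writing p +
iq = (1 + i) ∏ (X - c), the map [p : q] becomes x ↦ i ∏ (x - c)/(x - c̄), and p, q are coprime
exactly when no root has its conjugate among the roots. The Cayley transform carries the lower roots
and the conjugates of the upper ones to disjoint multisets A, B in the open disc. The map is then i
times a quotient of normalized Blaschke products, of degree |A| - |B| with |A| + |B| = n.

Such a map is z^d exp(2πi u(z)), with u the boundary value of an explicit harmonic function U on the
closed disc, U(1) = 1/4. Multiplying all zeros by r in (0, 1] replaces U(z) by U(rz) - U(r) + 1/4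
and keeps A, B disjoint (`shrink_mem_angleFunctions`). At r = 0 zeros may collide, but the functions
converge uniformly to the constant 1/4, so on the closure the scaling is a contraction.

To pass from functions to maps: by the maximum principle restriction to the circle is isometric
(`isometry_restrictCircle`), and circle maps uniformly closer than 2 are never antipodal, so they
share their degree and, if they agree at 1, have close lifts (`exists_eq_ofLift_of_dist_lt`,
`dist_le_of_dist_ofLift_lt`). Hence the degree is locally constant on the closure, and its fibres
are homeomorphic to closures of sets of angle functions
(`nonempty_homeomorph_closure_angleFunctions`). -/

namespace RP1

/-! ### The projective line as the unit circle -/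

theorem sub_mul_I_ne_zero {v : Fin 2 → ℝ} (hv : v ≠ 0) :
    (v 0 : ℂ) - v 1 * Complex.I ≠ 0 := by
  intro h
  apply hv
  have h0 := congrArg Complex.re h
  have h1 := congrArg Complex.im h
  simp at h0 h1
  ext i
  fin_cases i <;> simp [h0, h1]

/-- The point `(v₀ + i v₁) / (v₀ - i v₁)` of the unit circle attached to a nonzero vector. -/
noncomputable def vecToCircle (v : {v : Fin 2 → ℝ // v ≠ 0}) : Circle :=
  Circle.ofConjDivSelf ((v.1 0 : ℂ) - v.1 1 * Complex.I) (sub_mul_I_ne_zero v.2)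

theorem coe_vecToCircle (v : {v : Fin 2 → ℝ // v ≠ 0}) :
    (vecToCircle v : ℂ) =
      ((v.1 0 : ℂ) + v.1 1 * Complex.I) / ((v.1 0 : ℂ) - v.1 1 * Complex.I) := by
  simp [vecToCircle]

theorem continuous_vecToCircle : Continuous vecToCircle := by
  refine Continuous.subtype_mk (f := fun v : {v : Fin 2 → ℝ // v ≠ 0} =>
    (starRingEnd ℂ) ((v.1 0 : ℂ) - v.1 1 * Complex.I) / ((v.1 0 : ℂ) - v.1 1 * Complex.I)) ?_
    (fun v => (vecToCircle v).2)
  have h (i : Fin 2) : Continuous fun v : {v : Fin 2 → ℝ // v ≠ 0} => (v.1 i : ℂ) :=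
    Complex.continuous_ofReal.comp ((continuous_apply i).comp continuous_subtype_val)
  have h' := (h 0).sub ((h 1).mul (continuous_const (y := Complex.I)))
  exact (Complex.continuous_conj.comp h').div h' fun v => sub_mul_I_ne_zero v.2

/-- The homeomorphism from the real projective line to the circle, as a map. -/
noncomputable def toCircle : RP1 → Circle :=
  Projectivization.lift vecToCircle (by
    rintro ⟨a, ha⟩ ⟨b, hb⟩ t rfl
    have ht : (t : ℂ) ≠ 0 := by
      rintro h
      simp at h
      simp [h] at ha
    ext
    rw [coe_vecToCircle, coe_vecToCircle]
    refine Eq.trans ?_ (mul_div_mul_left _ _ ht)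
    simp [mul_add, mul_sub, mul_assoc])

theorem toCircle_mk (v : Fin 2 → ℝ) (hv : v ≠ 0) :
    (toCircle (Projectivization.mk ℝ v hv) : ℂ) =
      ((v 0 : ℂ) + v 1 * Complex.I) / ((v 0 : ℂ) - v 1 * Complex.I) :=
  coe_vecToCircle ⟨v, hv⟩

theorem continuous_toCircle : Continuous toCircle :=
  continuous_coinduced_dom.2 continuous_vecToCircle

/-- A unit vector at angle πθ is divided by its conjugate, which doubles the angle. -/
theorem toCircle_cover (θ : ℝ) : toCircle (cover θ) = Circle.exp (2 * Real.pi * θ) := by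
  ext
  rw [cover, toCircle_mk]
  have h1 : (Real.cos (Real.pi * θ) : ℂ) + Real.sin (Real.pi * θ) * Complex.I =
      Complex.exp ((Real.pi * θ : ℝ) * Complex.I) := by
    rw [Complex.exp_mul_I]; push_cast; rfl
  have h2 : (Real.cos (Real.pi * θ) : ℂ) - Real.sin (Real.pi * θ) * Complex.I =
      Complex.exp (-((Real.pi * θ : ℝ) * Complex.I)) := by
    rw [← neg_mul, Complex.exp_mul_I]; push_cast; simp [sub_eq_add_neg]
  simp only [Matrix.cons_val_zero, Matrix.cons_val_one]
  rw [h1, h2, ← Complex.exp_sub, Circle.coe_exp]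
  congr 1
  push_cast
  ring

theorem continuous_cover : Continuous cover := by
  have : Continuous fun θ : ℝ => (⟨![Real.cos (Real.pi * θ), Real.sin (Real.pi * θ)],
      vec_cos_sin_ne_zero _⟩ : {v : Fin 2 → ℝ // v ≠ 0}) := by
    refine Continuous.subtype_mk ?_ _
    refine continuous_pi fun i => ?_
    fin_cases i
    · simp; fun_prop
    · simp; fun_prop
  exact (continuous_coinduced_rng (f := fun v : {v : Fin 2 → ℝ // v ≠ 0} =>
    Projectivization.mk ℝ v.1 v.2)).comp this

theorem cover_add_one (θ : ℝ) : cover (θ + 1) = cover θ := by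
  rw [cover, cover, Projectivization.mk_eq_mk_iff']
  refine ⟨-1, ?_⟩
  ext i
  fin_cases i <;> simp [mul_add, Real.cos_add_pi, Real.sin_add_pi]

theorem periodic_cover : Function.Periodic cover 1 := cover_add_one

theorem cover_surjective : Function.Surjective cover := by
  intro x
  obtain ⟨v, hv, rfl⟩ : ∃ v hv, x = Projectivization.mk ℝ v hv :=
    ⟨x.rep, x.rep_nonzero, x.mk_rep.symm⟩
  refine ⟨Complex.arg (⟨v 0, v 1⟩ : ℂ) / Real.pi, ?_⟩
  rw [cover, Projectivization.mk_eq_mk_iff']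
  have h0 : (⟨v 0, v 1⟩ : ℂ) ≠ 0 := by
    intro h
    apply hv
    have h0 := congrArg Complex.re h
    have h1 := congrArg Complex.im h
    simp at h0 h1
    ext i
    fin_cases i <;> simp [h0, h1]
  have hn : ‖(⟨v 0, v 1⟩ : ℂ)‖ ≠ 0 := norm_ne_zero_iff.2 h0
  refine ⟨‖(⟨v 0, v 1⟩ : ℂ)‖⁻¹, ?_⟩
  rw [mul_div_cancel₀ _ Real.pi_ne_zero, Complex.cos_arg h0, Complex.sin_arg]
  ext i
  fin_cases i <;> simp <;> field_simp

theorem toCircle_injective : Function.Injective toCircle := by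
  intro x y h
  obtain ⟨θ, rfl⟩ := cover_surjective x
  obtain ⟨η, rfl⟩ := cover_surjective y
  rw [toCircle_cover, toCircle_cover, Circle.exp_eq_exp] at h
  obtain ⟨m, hm⟩ := h
  have : θ = η + m * 1 := by
    have := Real.pi_pos
    have h2 : 2 * Real.pi * θ = 2 * Real.pi * (η + m * 1) := by rw [hm]; ring
    exact mul_left_cancel₀ (by positivity) h2
  rw [this]
  exact periodic_cover.int_mul m η

theorem toCircle_surjective : Function.Surjective toCircle := by
  intro z
  obtain ⟨t, rfl⟩ := Circle.exp_surjective z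
  refine ⟨cover (t / (2 * Real.pi)), ?_⟩
  rw [toCircle_cover, mul_div_cancel₀]
  exact Real.two_pi_pos.ne'

instance : CompactSpace RP1 := by
  refine ⟨?_⟩
  have h : cover '' Set.Icc 0 1 = Set.univ := by
    refine Set.eq_univ_of_forall fun x => ?_
    obtain ⟨θ, rfl⟩ := cover_surjective x
    refine ⟨Int.fract θ, ⟨Int.fract_nonneg _, (Int.fract_lt_one _).le⟩, ?_⟩
    have := periodic_cover.sub_int_mul_eq ⌊θ⌋ (x := θ)
    rwa [mul_one] at this
  rw [← h]
  exact isCompact_Icc.image continuous_cover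

/-- The real projective line is homeomorphic to the circle. -/
noncomputable def homeoCircle : RP1 ≃ₜ Circle :=
  Continuous.homeoOfEquivCompactToT2
    (f := Equiv.ofBijective toCircle ⟨toCircle_injective, toCircle_surjective⟩)
    continuous_toCircle

@[simp] theorem homeoCircle_apply (x : RP1) : homeoCircle x = toCircle x := rfl

theorem toCircle_infty : toCircle infty = 1 := by
  ext
  rw [infty, toCircle_mk]
  simp

/-- The image `i` of the basepoint `[1 : 1]` in the circle. -/
theorem toCircle_base : (toCircle base : ℂ) = Complex.I := by
  rw [base, toCircle_mk]
  have : (1 : ℂ) - Complex.I ≠ 0 := by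
    intro h
    simpa using congrArg Complex.im h
  simp
  rw [div_eq_iff this]
  ring_nf
  simp
  ring

theorem coe_toCircle_affine (x : ℝ) :
    (toCircle (affine x) : ℂ) = (x + Complex.I) / (x - Complex.I) := by
  rw [affine, toCircle_mk]
  simp

theorem exists_affine_of_ne_infty {y : RP1} (hy : y ≠ infty) : ∃ x, y = affine x := by
  obtain ⟨v, hv, rfl⟩ : ∃ v hv, y = Projectivization.mk ℝ v hv :=
    ⟨y.rep, y.rep_nonzero, y.mk_rep.symm⟩
  have h1 : v 1 ≠ 0 := by
    intro h1
    apply hy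
    rw [infty, Projectivization.mk_eq_mk_iff']
    refine ⟨v 0, ?_⟩
    ext i
    fin_cases i <;> simp [h1]
  refine ⟨v 0 / v 1, ?_⟩
  rw [affine, Projectivization.mk_eq_mk_iff']
  refine ⟨v 1, ?_⟩
  ext i
  fin_cases i <;> simp
  field_simp

/-- Self-maps of the projective line as self-maps of the circle. -/
noncomputable def mapHomeo : C(RP1, RP1) ≃ₜ C(Circle, Circle) :=
  Homeomorph.arrowCongr homeoCircle homeoCircle

theorem mapHomeo_apply (f : C(RP1, RP1)) (x : RP1) :
    mapHomeo f (toCircle x) = toCircle (f x) := by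
  change homeoCircle (f (homeoCircle.symm (homeoCircle x))) = _
  rw [Homeomorph.symm_apply_apply, homeoCircle_apply]

end RP1

/-! ### Circle maps and their lifts -/

/-- The self-map `z ↦ z ^ d * exp (2πi u(z))` of the circle. -/
noncomputable def ofLift (d : ℤ) (u : C(Circle, ℝ)) : C(Circle, Circle) where
  toFun z := z ^ d * Circle.exp (2 * Real.pi * u z)
  continuous_toFun := by
    exact (continuous_zpow d).mul (Circle.exp.continuous.comp (by fun_prop))

theorem ofLift_apply (d : ℤ) (u : C(Circle, ℝ)) (z : Circle) :
    ofLift d u z = z ^ d * Circle.exp (2 * Real.pi * u z) := rfl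

theorem continuous_ofLift (d : ℤ) : Continuous (ofLift d) := by
  refine ContinuousMap.continuous_of_continuous_uncurry _ ?_
  refine ((continuous_zpow d).comp continuous_snd).mul (Circle.exp.continuous.comp ?_)
  have : Continuous fun p : C(Circle, ℝ) × Circle => p.1 p.2 := by fun_prop
  exact continuous_const.mul this

theorem Circle.norm_exp_sub_one (t : ℝ) : ‖(Circle.exp t : ℂ) - 1‖ = 2 * |Real.sin (t / 2)| := by
  rw [Circle.coe_exp, mul_comm, Complex.norm_exp_I_mul_ofReal_sub_one, norm_mul, Real.norm_eq_abs,
    Real.norm_eq_abs, abs_two]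

theorem Circle.dist_exp_exp (s t : ℝ) :
    dist (Circle.exp s) (Circle.exp t) = 2 * |Real.sin ((s - t) / 2)| := by
  rw [← Circle.norm_exp_sub_one, Circle.exp_sub, Circle.coe_div]
  change dist (Circle.exp s : ℂ) (Circle.exp t : ℂ) = _
  rw [div_sub_one (Circle.coe_ne_zero _), norm_div, Circle.norm_coe, div_one, dist_eq_norm]

/-- A continuous function on a connected space vanishing somewhere, whose exponential stays away
from `-1`, is controlled by its exponential. -/
theorem abs_le_of_dist_exp_lt {X : Type*} [TopologicalSpace X] [PreconnectedSpace X]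
    {w : X → ℝ} (hw : Continuous w) {x₀ : X} (h0 : w x₀ = 0)
    (h : ∀ x, dist (Circle.exp (w x)) 1 < 2) (x : X) :
    |w x| ≤ Real.pi / 2 * dist (Circle.exp (w x)) 1 := by
  have hd (x) : dist (Circle.exp (w x)) 1 = 2 * |Real.sin (w x / 2)| := by
    simpa using Circle.dist_exp_exp (w x) 0
  have hlt : |w x| < Real.pi := by
    -- Otherwise |w| takes the value π by the intermediate value theorem, and there the exponential
    -- is -1, at distance 2 from 1.
    by_contra! hx
    have hmem : Real.pi ∈ Set.range fun x => |w x| :=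
      mem_range_of_exists_le_of_exists_ge (continuous_abs.comp hw)
        ⟨x₀, by simp [h0, Real.pi_pos.le]⟩ ⟨x, hx⟩
    obtain ⟨y, hy⟩ := hmem
    have := h y
    rw [hd] at this
    rcases abs_eq Real.pi_pos.le |>.1 hy with hy | hy <;> rw [hy] at this <;>
      simp [neg_div] at this
  -- Jordan's inequality, available because |w x / 2| ≤ π/2.
  have := Real.mul_abs_le_abs_sin (x := w x / 2) (by
    rw [abs_div, abs_two]; linarith)
  rw [hd]
  rw [abs_div, abs_two] at this
  have hpi := Real.pi_pos
  calc |w x| = Real.pi * (2 / Real.pi * (|w x| / 2)) := by field_simp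
    _ ≤ Real.pi * |Real.sin (w x / 2)| := by gcongr
    _ = _ := by ring

theorem dist_ofLift_apply (d : ℤ) (u v : C(Circle, ℝ)) (z : Circle) :
    dist (ofLift d u z) (ofLift d v z) =
      dist (Circle.exp (2 * Real.pi * u z - 2 * Real.pi * v z)) 1 := by
  have key (a b c : Circle) : dist (a * b) (a * c) = dist (b / c) 1 := by
    change dist ((a * b : Circle) : ℂ) ((a * c : Circle) : ℂ) = dist ((b / c : Circle) : ℂ) 1
    rw [dist_eq_norm, dist_eq_norm, Circle.coe_div, div_sub_one (Circle.coe_ne_zero _), norm_div,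
      Circle.coe_mul, Circle.coe_mul, ← mul_sub, norm_mul, Circle.norm_coe, Circle.norm_coe,
      div_one, one_mul]
  rw [ofLift_apply, ofLift_apply, key, Circle.exp_sub]

/-- The common factor z^d cancels, and 2π(u - v) vanishes at 1, so `abs_le_of_dist_exp_lt` applies.
The constant is (π/2)/(2π) = 1/4. -/
theorem dist_le_of_dist_ofLift_lt {d : ℤ} {u v : C(Circle, ℝ)} (h1 : u 1 = v 1)
    (h : dist (ofLift d u) (ofLift d v) < 2) :
    dist u v ≤ dist (ofLift d u) (ofLift d v) / 4 := by
  rw [ContinuousMap.dist_le (by positivity)]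
  intro z
  have hz := fun z => (ContinuousMap.dist_apply_le_dist z).trans_lt h
  have := abs_le_of_dist_exp_lt (w := fun z : Circle => 2 * Real.pi * u z - 2 * Real.pi * v z)
    (by fun_prop) (x₀ := 1) (by simp [h1]) (fun z => by rw [← dist_ofLift_apply d]; exact hz z) z
  rw [← dist_ofLift_apply d, ← mul_sub, abs_mul, abs_of_pos Real.two_pi_pos] at this
  rw [Real.dist_eq]
  have hpi := Real.pi_pos
  have h2 := ContinuousMap.dist_apply_le_dist (f := ofLift d u) (g := ofLift d v) z
  have h3 : 2 * Real.pi * |u z - v z| ≤ 2 * Real.pi * (dist (ofLift d u z) (ofLift d v z) / 4) := by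
    linarith
  have := le_of_mul_le_mul_left h3 (by positivity)
  linarith

theorem Circle.mem_slitPlane_of_dist_lt {z : Circle} (h : dist z 1 < 2) :
    (z : ℂ) ∈ Complex.slitPlane := by
  rw [Complex.mem_slitPlane_iff_arg]
  refine ⟨fun harg => ?_, Circle.coe_ne_zero z⟩
  rw [← Circle.exp_arg z, harg] at h
  have := Circle.dist_exp_exp Real.pi 0
  simp at this
  simp [this] at h

/-- A self-map of the circle close to one with a lift has a lift of the same degree. -/
theorem exists_eq_ofLift_of_dist_lt {d : ℤ} {v : C(Circle, ℝ)} {f : C(Circle, Circle)}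
    (h : dist f (ofLift d v) < 2) :
    ∃ u, f = ofLift d u ∧ (f 1 = ofLift d v 1 → u 1 = v 1) := by
  -- The quotient of the two maps avoids -1, so its principal argument is continuous and corrects
  -- `v`.
  have hz (z) : ((f z / ofLift d v z : Circle) : ℂ) ∈ Complex.slitPlane := by
    apply Circle.mem_slitPlane_of_dist_lt
    refine lt_of_eq_of_lt ?_ ((ContinuousMap.dist_apply_le_dist z).trans_lt h)
    change dist ((_ : Circle) : ℂ) 1 = dist (f z : ℂ) (ofLift d v z : ℂ)
    rw [dist_eq_norm, dist_eq_norm, Circle.coe_div, div_sub_one (Circle.coe_ne_zero _), norm_div,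
      Circle.norm_coe, div_one]
  refine ⟨⟨fun z => v z + Complex.arg (f z / ofLift d v z : Circle) / (2 * Real.pi), ?_⟩, ?_,
    fun h1 => by simp [h1]⟩
  · refine v.continuous.add (Continuous.div_const ?_ _)
    rw [continuous_iff_continuousAt]
    intro z
    refine (Complex.continuousAt_arg (hz z)).comp
      (f := fun z => ((f z / ofLift d v z : Circle) : ℂ)) ?_
    refine Continuous.continuousAt ?_
    exact continuous_subtype_val.comp (f.continuous.div' (ofLift d v).continuous)
  · ext1 z
    rw [ofLift_apply]
    simp only [ContinuousMap.coe_mk]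
    rw [mul_add, mul_div_cancel₀ _ Real.two_pi_pos.ne', Circle.exp_add, Circle.exp_arg, ← mul_assoc,
      ← ofLift_apply]
    simp

/-! ### The topological degree -/

namespace RP1

theorem hasDegree_mapHomeo_symm_ofLift (d : ℤ) (u : C(Circle, ℝ)) :
    HasDegree (mapHomeo.symm (ofLift d u)) d := by
  refine ⟨fun θ => d * θ + u (Circle.exp (2 * Real.pi * θ)), ?_, fun θ => ?_, fun θ => ?_⟩
  · have := Circle.exp.continuous
    exact (continuous_const.mul continuous_id).add
      (u.continuous.comp (Circle.exp.continuous.comp (by fun_prop)))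
  · apply toCircle_injective
    rw [← mapHomeo_apply, Homeomorph.apply_symm_apply, toCircle_cover, toCircle_cover,
      ofLift_apply, mul_add, Circle.exp_add, ← Circle.exp_intCast_mul]
    ring_nf
  · have : Circle.exp (2 * Real.pi * (θ + 1)) = Circle.exp (2 * Real.pi * θ) := by
      rw [mul_add, mul_one, Circle.exp_add_two_pi]
    simp only [this]
    ring

/-- Two lifts of the same map differ by a continuous integer-valued function, which is constant. -/
theorem HasDegree.unique {f : C(RP1, RP1)} {d e : ℤ} (hd : HasDegree f d) (he : HasDegree f e) :
    d = e := by
  obtain ⟨F, hF, hfF, hFd⟩ := hd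
  obtain ⟨G, hG, hfG, hGe⟩ := he
  have hint (θ) : ∃ m : ℤ, F θ - G θ = m := by
    have h : toCircle (cover (F θ)) = toCircle (cover (G θ)) := by rw [← hfF, ← hfG]
    rw [toCircle_cover, toCircle_cover, Circle.exp_eq_exp] at h
    obtain ⟨m, hm⟩ := h
    refine ⟨m, ?_⟩
    have hpi := Real.two_pi_pos
    refine mul_left_cancel₀ hpi.ne' ?_
    linarith
  choose m hm using hint
  have hmc : Continuous m := by
    rw [Int.isClosedEmbedding_coe_real.isEmbedding.continuous_iff]
    exact (hF.sub hG).congr hm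
  have h01 : m (0 + 1) = m 0 := PreconnectedSpace.constant inferInstance hmc
  have h1 := hm (0 + 1)
  rw [h01, ← hm, hFd, hGe] at h1
  have : (d : ℝ) = e := by linarith
  exact_mod_cast this

end RP1

/-! ### The maximum principle on the closed disc -/

/-- The closed unit disc. -/
abbrev ClosedDisc : Type := Metric.closedBall (0 : ℂ) 1

theorem ClosedDisc.norm_le (z : ClosedDisc) : ‖(z : ℂ)‖ ≤ 1 := mem_closedBall_zero_iff.1 z.2

/-- The inclusion of the circle into the closed disc. -/
noncomputable def Circle.toClosedDisc : C(Circle, ClosedDisc) where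
  toFun z := ⟨z, mem_closedBall_zero_iff.2 (Circle.norm_coe z).le⟩
  continuous_toFun := Continuous.subtype_mk continuous_subtype_val _

@[simp] theorem Circle.coe_toClosedDisc (z : Circle) : (z.toClosedDisc : ℂ) = z := rfl

/-- Restriction of functions from the closed disc to the circle. -/
noncomputable def restrictCircle (U : C(ClosedDisc, ℝ)) : C(Circle, ℝ) := U.comp Circle.toClosedDisc

@[simp] theorem restrictCircle_apply (U : C(ClosedDisc, ℝ)) (z : Circle) :
    restrictCircle U z = U z.toClosedDisc := rfl

theorem continuous_restrictCircle : Continuous restrictCircle :=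
  ContinuousMap.continuous_precomp _

/-- A function which, on the closed unit disc, is the imaginary part of a holomorphic function. -/
def IsImHolomorphic (u : ℂ → ℝ) : Prop :=
  ∃ G : ℂ → ℂ, DifferentiableOn ℂ G (Metric.closedBall 0 1) ∧
    ∀ z ∈ Metric.closedBall (0 : ℂ) 1, u z = (G z).im

namespace IsImHolomorphic

theorem const (c : ℝ) : IsImHolomorphic fun _ => c :=
  ⟨fun _ => c * Complex.I, differentiableOn_const _, by simp⟩

theorem add {u v : ℂ → ℝ} (hu : IsImHolomorphic u) (hv : IsImHolomorphic v) :
    IsImHolomorphic fun z => u z + v z := by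
  obtain ⟨G, hG, h⟩ := hu
  obtain ⟨H, hH, h'⟩ := hv
  exact ⟨fun z => G z + H z, hG.add hH, fun z hz => by simp [h z hz, h' z hz]⟩

theorem sub {u v : ℂ → ℝ} (hu : IsImHolomorphic u) (hv : IsImHolomorphic v) :
    IsImHolomorphic fun z => u z - v z := by
  obtain ⟨G, hG, h⟩ := hu
  obtain ⟨H, hH, h'⟩ := hv
  exact ⟨fun z => G z - H z, hG.sub hH, fun z hz => by simp [h z hz, h' z hz]⟩

theorem multiset_sum {ι : Type*} {A : Multiset ι} {u : ι → ℂ → ℝ}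
    (h : ∀ a ∈ A, IsImHolomorphic (u a)) :
    IsImHolomorphic fun z => (A.map fun a => u a z).sum := by
  induction A using Multiset.induction with
  | empty => simpa using const 0
  | cons a A ih =>
    simp only [Multiset.map_cons, Multiset.sum_cons]
    exact (h a (Multiset.mem_cons_self a A)).add
      (ih fun b hb => h b (Multiset.mem_cons_of_mem hb))

/-- The maximum modulus principle for exp(-iG), whose modulus is exp(Im G); the exponential turns a
one-sided bound into a bound on a modulus. -/
theorem le_of_forall_norm_eq_one_le {u : ℂ → ℝ} (hu : IsImHolomorphic u) {C : ℝ}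
    (hC : ∀ z : ℂ, ‖z‖ = 1 → u z ≤ C) {z : ℂ} (hz : ‖z‖ ≤ 1) : u z ≤ C := by
  obtain ⟨G, hG, h⟩ := hu
  have hcl : closure (Metric.ball (0 : ℂ) 1) = Metric.closedBall 0 1 :=
    closure_ball 0 one_ne_zero
  have hnorm (w : ℂ) (hw : ‖w‖ ≤ 1) : ‖Complex.exp (-Complex.I * G w)‖ = Real.exp (u w) := by
    rw [Complex.norm_exp, h w (mem_closedBall_zero_iff.2 hw)]
    simp
  have hd : DiffContOnCl ℂ (fun w => Complex.exp (-Complex.I * G w)) (Metric.ball 0 1) := by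
    apply DifferentiableOn.diffContOnCl
    rw [hcl]
    exact (hG.const_mul _).cexp
  have := Complex.norm_le_of_forall_mem_frontier_norm_le Metric.isBounded_ball hd
    (C := Real.exp C) (fun w hw => by
      rw [frontier_ball 0 one_ne_zero, mem_sphere_zero_iff_norm] at hw
      rw [hnorm w hw.le]
      exact Real.exp_le_exp.2 (hC w hw)) (z := z) (by
      rw [hcl]
      exact mem_closedBall_zero_iff.2 hz)
  rw [hnorm z hz] at this
  exact Real.exp_le_exp.1 this

theorem abs_le_of_forall_norm_eq_one_le {u : ℂ → ℝ} (hu : IsImHolomorphic u) {C : ℝ}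
    (hC : ∀ z : ℂ, ‖z‖ = 1 → |u z| ≤ C) {z : ℂ} (hz : ‖z‖ ≤ 1) : |u z| ≤ C := by
  rw [abs_le']
  refine ⟨hu.le_of_forall_norm_eq_one_le (fun w hw => (le_abs_self _).trans (hC w hw)) hz, ?_⟩
  have := ((const 0).sub hu).le_of_forall_norm_eq_one_le
    (fun w hw => by simpa using (neg_le_abs _).trans (hC w hw)) hz
  simpa using this

end IsImHolomorphic

/-! ### Blaschke factors and angle functions -/

theorem one_sub_conj_mul_re_pos {a z : ℂ} (ha : ‖a‖ < 1) (hz : ‖z‖ ≤ 1) :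
    0 < (1 - (starRingEnd ℂ) a * z).re := by
  have h1 := Complex.re_le_norm ((starRingEnd ℂ) a * z)
  rw [norm_mul, RCLike.norm_conj] at h1
  have h2 : ‖a‖ * ‖z‖ < 1 := by nlinarith [norm_nonneg a, norm_nonneg z]
  rw [Complex.sub_re, Complex.one_re]
  linarith

theorem one_sub_conj_mul_mem_slitPlane {a z : ℂ} (ha : ‖a‖ < 1) (hz : ‖z‖ ≤ 1) :
    1 - (starRingEnd ℂ) a * z ∈ Complex.slitPlane :=
  Or.inl (one_sub_conj_mul_re_pos ha hz)

/-- On the unit circle, `z * exp (2πi blaschkeArg a z)` is the Blaschke factor with zero `a`,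
normalized to take the value `1` at `1`. -/
noncomputable def blaschkeArg (a z : ℂ) : ℝ :=
  -(Complex.arg (1 - (starRingEnd ℂ) a * z) - Complex.arg (1 - (starRingEnd ℂ) a)) / Real.pi

/-- The values 1 - ā z stay in the right half-plane, where the principal logarithm is holomorphic.
-/
theorem isImHolomorphic_blaschkeArg {a : ℂ} (ha : ‖a‖ < 1) : IsImHolomorphic (blaschkeArg a) := by
  refine ⟨fun z => -(Complex.log (1 - (starRingEnd ℂ) a * z) -
    Complex.log (1 - (starRingEnd ℂ) a)) / (Real.pi : ℂ), ?_, fun z _ => ?_⟩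
  · refine DifferentiableOn.div_const (DifferentiableOn.neg (DifferentiableOn.sub_const ?_ _)) _
    refine DifferentiableOn.clog (by fun_prop) fun z hz => ?_
    exact one_sub_conj_mul_mem_slitPlane ha (mem_closedBall_zero_iff.1 hz)
  · rw [Complex.div_ofReal_im, Complex.neg_im, Complex.sub_im, Complex.log_im, Complex.log_im]
    rfl

theorem continuous_blaschkeArg {a : ℂ} (ha : ‖a‖ < 1) :
    Continuous fun z : ClosedDisc => blaschkeArg a z := by
  unfold blaschkeArg
  refine Continuous.div_const (Continuous.neg (Continuous.sub ?_ continuous_const)) _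
  rw [continuous_iff_continuousAt]
  intro z
  refine (Complex.continuousAt_arg (one_sub_conj_mul_mem_slitPlane ha z.norm_le)).comp
    (f := fun z : ClosedDisc => 1 - (starRingEnd ℂ) a * (z : ℂ)) ?_
  fun_prop

@[simp] theorem blaschkeArg_one (a : ℂ) : blaschkeArg a 1 = 0 := by simp [blaschkeArg]

/-- Only the product ā z enters, so a real factor can be moved from the zero to the variable. This
makes scaling the zeros the same as radial restriction. -/
theorem blaschkeArg_mul (a z : ℂ) (r : ℝ) :
    blaschkeArg (r * a) z = blaschkeArg a (r * z) - blaschkeArg a r := by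
  have h (w : ℂ) : (starRingEnd ℂ) (r * a) * w = (starRingEnd ℂ) a * (r * w) := by
    simp; ring
  have h1 := h 1
  rw [mul_one, mul_one] at h1
  rw [blaschkeArg, h z, h1, blaschkeArg, blaschkeArg]
  ring

/-- The angle function of a quotient of products of Blaschke factors with zeros `A` and `B`. -/
noncomputable def blaschkeSum (A B : Multiset ℂ) (z : ℂ) : ℝ :=
  1 / 4 + (A.map fun a => blaschkeArg a z).sum - (B.map fun b => blaschkeArg b z).sum

theorem isImHolomorphic_blaschkeSum {A B : Multiset ℂ} (hA : ∀ a ∈ A, ‖a‖ < 1)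
    (hB : ∀ b ∈ B, ‖b‖ < 1) : IsImHolomorphic (blaschkeSum A B) :=
  ((IsImHolomorphic.const _).add
    (.multiset_sum fun a ha => isImHolomorphic_blaschkeArg (hA a ha))).sub
    (.multiset_sum fun b hb => isImHolomorphic_blaschkeArg (hB b hb))

theorem continuous_blaschkeSum {A B : Multiset ℂ} (hA : ∀ a ∈ A, ‖a‖ < 1)
    (hB : ∀ b ∈ B, ‖b‖ < 1) : Continuous fun z : ClosedDisc => blaschkeSum A B z :=
  (continuous_const.add
    (continuous_multiset_sum _ fun a ha => continuous_blaschkeArg (hA a ha))).sub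
    (continuous_multiset_sum _ fun b hb => continuous_blaschkeArg (hB b hb))

theorem blaschkeSum_one (A B : Multiset ℂ) : blaschkeSum A B 1 = 1 / 4 := by
  simp [blaschkeSum]

theorem blaschkeSum_map_mul (A B : Multiset ℂ) (z : ℂ) (r : ℝ) :
    blaschkeSum (A.map fun a => r * a) (B.map fun b => r * b) z =
      blaschkeSum A B (r * z) - blaschkeSum A B r + 1 / 4 := by
  simp only [blaschkeSum, Multiset.map_map, Function.comp_def, blaschkeArg_mul,
    Multiset.sum_map_sub]
  ring

/-- The functions on the closed disc whose boundary values are the normalized angle functions of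
the real rational maps of algebraic degree `n` and topological degree `d`. -/
noncomputable def angleFunctions (n : ℕ) (d : ℤ) : Set C(ClosedDisc, ℝ) :=
  {U | ∃ A B : Multiset ℂ, (∀ a ∈ A, ‖a‖ < 1) ∧ (∀ b ∈ B, ‖b‖ < 1) ∧ (∀ a ∈ A, a ∉ B) ∧
    A.card + B.card = n ∧ (A.card : ℤ) - B.card = d ∧
    ∀ z : ClosedDisc, U z = blaschkeSum A B z}

theorem angleFunctions_nonempty {n : ℕ} {d : ℤ} (h1 : -(n : ℤ) ≤ d) (h2 : d ≤ n)
    (h3 : d ≡ n [ZMOD 2]) : (angleFunctions n d).Nonempty := by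
  obtain ⟨k, l, hk, hl⟩ : ∃ k l : ℕ, k + l = n ∧ (k : ℤ) - l = d := by
    refine ⟨((n + d) / 2).toNat, ((n - d) / 2).toNat, ?_, ?_⟩ <;>
    · have := h3.eq
      omega
  -- Any two distinct points of the disc, repeated `k` and `l` times, would serve.
  have hA : ∀ a ∈ Multiset.replicate k (0 : ℂ), ‖a‖ < 1 := fun a ha => by
    rw [Multiset.eq_of_mem_replicate ha]; simp
  have hB : ∀ b ∈ Multiset.replicate l (1 / 2 : ℂ), ‖b‖ < 1 := fun b hb => by
    rw [Multiset.eq_of_mem_replicate hb]; norm_num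
  refine ⟨⟨_, continuous_blaschkeSum hA hB⟩, _, _, hA, hB, fun a ha hb => ?_, by simpa, by simpa,
    fun z => rfl⟩
  have h := Multiset.eq_of_mem_replicate ha
  rw [Multiset.eq_of_mem_replicate hb] at h
  norm_num at h

/-- The difference of two angle functions is again an imaginary part of a holomorphic function, so
its maximum modulus is attained on the circle. -/
theorem dist_le_dist_restrictCircle {n : ℕ} {d : ℤ} {U V : C(ClosedDisc, ℝ)}
    (hU : U ∈ angleFunctions n d) (hV : V ∈ angleFunctions n d) :
    dist U V ≤ dist (restrictCircle U) (restrictCircle V) := by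
  obtain ⟨A, B, hA, hB, -, -, -, hUz⟩ := hU
  obtain ⟨A', B', hA', hB', -, -, -, hVz⟩ := hV
  rw [ContinuousMap.dist_le dist_nonneg]
  intro z
  rw [hUz, hVz, Real.dist_eq]
  refine ((isImHolomorphic_blaschkeSum hA hB).sub
    (isImHolomorphic_blaschkeSum hA' hB')).abs_le_of_forall_norm_eq_one_le
      (fun w hw => ?_) z.norm_le
  obtain ⟨w, rfl⟩ : ∃ w' : Circle, (w' : ℂ) = w := ⟨⟨w, mem_sphere_zero_iff_norm.2 hw⟩, rfl⟩
  have := ContinuousMap.dist_apply_le_dist (f := restrictCircle U) (g := restrictCircle V) w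
  rw [restrictCircle_apply, restrictCircle_apply, hUz, hVz, Real.dist_eq] at this
  exact this

theorem dist_restrictCircle_le (U V : C(ClosedDisc, ℝ)) :
    dist (restrictCircle U) (restrictCircle V) ≤ dist U V := by
  rw [ContinuousMap.dist_le dist_nonneg]
  exact fun z => ContinuousMap.dist_apply_le_dist (f := U) (g := V) _

/-- By the maximum principle, restriction to the circle is isometric on limits of angle
functions. -/
theorem isometry_restrictCircle (n : ℕ) (d : ℤ) :
    Isometry fun U : closure (angleFunctions n d) => restrictCircle U := by
  refine Isometry.of_dist_eq fun U V => le_antisymm (dist_restrictCircle_le _ _) ?_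
  obtain ⟨U, hU⟩ := U
  obtain ⟨V, hV⟩ := V
  change dist U V ≤ dist (restrictCircle U) (restrictCircle V)
  have hc := continuous_restrictCircle
  have h1 : ∀ U ∈ angleFunctions n d, dist U V ≤ dist (restrictCircle U) (restrictCircle V) := by
    intro U hU
    have hcl : IsClosed {V | dist U V ≤ dist (restrictCircle U) (restrictCircle V)} :=
      isClosed_le (continuous_const.dist continuous_id) (continuous_const.dist hc)
    exact hcl.closure_subset_iff.2 (fun V hV => dist_le_dist_restrictCircle hU hV) hV
  have hcl : IsClosed {U | dist U V ≤ dist (restrictCircle U) (restrictCircle V)} :=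
    isClosed_le (continuous_id.dist continuous_const) (hc.dist continuous_const)
  exact hcl.closure_subset_iff.2 h1 hU

/-- An isometric image of a complete space is closed. -/
theorem closure_image_restrictCircle_subset (n : ℕ) (d : ℤ) :
    closure (restrictCircle '' angleFunctions n d) ⊆
      restrictCircle '' closure (angleFunctions n d) := by
  have : CompleteSpace (closure (angleFunctions n d)) := isClosed_closure.completeSpace_coe
  have hc := (isometry_restrictCircle n d).isClosedEmbedding.isClosed_range
  refine closure_minimal (Set.image_mono subset_closure) ?_
  rwa [Set.image_eq_range]

theorem apply_one_of_mem_closure_angleFunctions {n : ℕ} {d : ℤ} {U : C(ClosedDisc, ℝ)}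
    (hU : U ∈ closure (angleFunctions n d)) : U (Circle.toClosedDisc 1) = 1 / 4 := by
  have hcl : IsClosed {U : C(ClosedDisc, ℝ) | U (Circle.toClosedDisc 1) = 1 / 4} :=
    isClosed_eq (continuous_eval_const _) continuous_const
  refine hcl.closure_subset_iff.2 ?_ hU
  rintro U ⟨A, B, -, -, -, -, -, h⟩
  simp [h, blaschkeSum_one]

/-! ### Contraction by radial scaling -/

/-- Radial scaling of the closed disc. -/
noncomputable def ClosedDisc.scale (r : unitInterval) (z : ClosedDisc) : ClosedDisc :=
  ⟨(r : ℝ) * z, by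
    rw [mem_closedBall_zero_iff, norm_mul, Complex.norm_real, Real.norm_of_nonneg r.2.1]
    exact mul_le_one₀ r.2.2 (norm_nonneg _) z.norm_le⟩

theorem ClosedDisc.continuous_scale :
    Continuous fun p : unitInterval × ClosedDisc => p.2.scale p.1 :=
  Continuous.subtype_mk ((Complex.continuous_ofReal.comp
    (continuous_subtype_val.comp continuous_fst)).mul
    (continuous_subtype_val.comp continuous_snd)) _

/-- The function `z ↦ U(rz)`, normalized at `1`. -/
noncomputable def shrink (r : unitInterval) (U : C(ClosedDisc, ℝ)) : C(ClosedDisc, ℝ) where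
  toFun z := U (z.scale r) - U ((Circle.toClosedDisc 1).scale r) + 1 / 4
  continuous_toFun := by
    have : Continuous fun z : ClosedDisc => z.scale r :=
      ClosedDisc.continuous_scale.comp (Continuous.prodMk_right r)
    fun_prop

theorem continuous_shrink :
    Continuous fun p : unitInterval × C(ClosedDisc, ℝ) => shrink p.1 p.2 := by
  refine ContinuousMap.continuous_of_continuous_uncurry _ ?_
  have h : Continuous fun q : (unitInterval × C(ClosedDisc, ℝ)) × ClosedDisc =>
      q.2.scale q.1.1 :=
    ClosedDisc.continuous_scale.comp (f := fun q : (unitInterval × C(ClosedDisc, ℝ)) × ClosedDisc =>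
      (q.1.1, q.2)) (by fun_prop)
  have h' : Continuous fun q : (unitInterval × C(ClosedDisc, ℝ)) × ClosedDisc =>
      (Circle.toClosedDisc 1).scale q.1.1 :=
    ClosedDisc.continuous_scale.comp (f := fun q : (unitInterval × C(ClosedDisc, ℝ)) × ClosedDisc =>
      (q.1.1, Circle.toClosedDisc 1)) (by fun_prop)
  have h1 : Continuous fun q : (unitInterval × C(ClosedDisc, ℝ)) × ClosedDisc =>
      q.1.2 (q.2.scale q.1.1) := by fun_prop
  have h2 : Continuous fun q : (unitInterval × C(ClosedDisc, ℝ)) × ClosedDisc =>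
      q.1.2 ((Circle.toClosedDisc 1).scale q.1.1) := by fun_prop
  exact (h1.sub h2).add_const _

/-- Scaling by r ≠ 0 is injective, so zeros in `A` and `B` stay distinct; r = 0 would make them
coincide. -/
theorem shrink_mem_angleFunctions {n : ℕ} {d : ℤ} {U : C(ClosedDisc, ℝ)}
    (hU : U ∈ angleFunctions n d) {r : unitInterval} (hr : r ≠ 0) :
    shrink r U ∈ angleFunctions n d := by
  obtain ⟨A, B, hA, hB, hAB, hn, hd, hUz⟩ := hU
  have hr0 : ((r : ℝ) : ℂ) ≠ 0 := by simpa using hr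
  have hlt (a : ℂ) (ha : ‖a‖ < 1) : ‖((r : ℝ) : ℂ) * a‖ < 1 := by
    rw [norm_mul, Complex.norm_real, Real.norm_of_nonneg r.2.1]
    exact (mul_le_of_le_one_left (norm_nonneg _) r.2.2).trans_lt ha
  refine ⟨A.map fun a => (r : ℝ) * a, B.map fun b => (r : ℝ) * b, ?_, ?_, ?_, by simpa, by simpa,
    fun z => ?_⟩
  · simp only [Multiset.mem_map]
    rintro _ ⟨a, ha, rfl⟩
    exact hlt a (hA a ha)
  · simp only [Multiset.mem_map]
    rintro _ ⟨a, ha, rfl⟩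
    exact hlt a (hB a ha)
  · simp only [Multiset.mem_map]
    rintro _ ⟨a, ha, rfl⟩ ⟨b, hb, hab⟩
    rw [mul_left_cancel₀ hr0 hab] at hb
    exact hAB a ha hb
  · rw [blaschkeSum_map_mul]
    change U _ - U _ + 1 / 4 = _
    rw [hUz, hUz]
    simp [ClosedDisc.scale]

/-- The value r = 0 is reached as a limit of r ≠ 0; this is where passing to the closure is
essential. -/
theorem shrink_mem_closure {n : ℕ} {d : ℤ} {U : C(ClosedDisc, ℝ)}
    (hU : U ∈ closure (angleFunctions n d)) (r : unitInterval) :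
    shrink r U ∈ closure (angleFunctions n d) := by
  have hne : ∀ r : unitInterval, r ≠ 0 → shrink r U ∈ closure (angleFunctions n d) := by
    intro r hr
    have hc : Continuous (shrink r) := continuous_shrink.comp (Continuous.prodMk_right r)
    exact map_mem_closure hc hU fun V hV => shrink_mem_angleFunctions hV hr
  have hc : Continuous fun r => shrink r U := continuous_shrink.comp (Continuous.prodMk_left U)
  have hcl : IsClosed {r | shrink r U ∈ closure (angleFunctions n d)} :=
    isClosed_closure.preimage hc
  have hd : Dense ({0}ᶜ : Set unitInterval) := dense_compl_singleton 0
  have := hcl.closure_subset_iff.2 (fun r (hr : r ∈ ({0}ᶜ : Set unitInterval)) => hne r hr)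
  exact this (hd r)

theorem shrink_one {U : C(ClosedDisc, ℝ)} (hU : U (Circle.toClosedDisc 1) = 1 / 4) :
    shrink 1 U = U := by
  ext z
  have h (z : ClosedDisc) : z.scale 1 = z := Subtype.ext (by simp [ClosedDisc.scale])
  change U _ - U _ + 1 / 4 = _
  rw [h, h, hU]
  ring

theorem shrink_zero (U V : C(ClosedDisc, ℝ)) : shrink 0 U = shrink 0 V := by
  ext z
  have h (z : ClosedDisc) : z.scale 0 = ⟨0, by simp⟩ := Subtype.ext (by simp [ClosedDisc.scale])
  change U _ - U _ + 1 / 4 = V _ - V _ + 1 / 4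
  rw [h, h]
  ring

theorem contractibleSpace_closure_angleFunctions {n : ℕ} {d : ℤ} (h1 : -(n : ℤ) ≤ d) (h2 : d ≤ n)
    (h3 : d ≡ n [ZMOD 2]) : ContractibleSpace (closure (angleFunctions n d)) := by
  obtain ⟨V, hV⟩ := angleFunctions_nonempty h1 h2 h3
  rw [contractible_iff_id_nullhomotopic]
  refine ⟨⟨shrink 0 V, shrink_mem_closure (subset_closure hV) 0⟩, ?_⟩
  refine ContinuousMap.Homotopic.symm ⟨⟨⟨fun p => ⟨shrink p.1 p.2, shrink_mem_closure p.2.2 p.1⟩,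
    ?_⟩, fun U => ?_, fun U => ?_⟩⟩
  · exact Continuous.subtype_mk (continuous_shrink.comp
      (continuous_fst.prodMk (continuous_subtype_val.comp continuous_snd))) _
  · exact Subtype.ext (shrink_zero _ _)
  · exact Subtype.ext (shrink_one (apply_one_of_mem_closure_angleFunctions U.2))

/-! ### Blaschke factors in the affine coordinate -/

theorem Complex.exp_neg_two_mul_arg {w : ℂ} (hw : w ≠ 0) :
    Complex.exp (-2 * Complex.arg w * Complex.I) = (starRingEnd ℂ) w / w := by
  have h := Complex.norm_mul_exp_arg_mul_I w
  have hc : (starRingEnd ℂ) w = ‖w‖ * Complex.exp (-(Complex.arg w * Complex.I)) := by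
    conv_lhs => rw [← h]
    rw [map_mul, Complex.conj_ofReal, ← Complex.exp_conj, map_mul, Complex.conj_ofReal,
      Complex.conj_I, mul_neg]
  rw [eq_div_iff hw]
  calc Complex.exp (-2 * Complex.arg w * Complex.I) * w
      = Complex.exp (-2 * Complex.arg w * Complex.I) *
          (‖w‖ * Complex.exp (Complex.arg w * Complex.I)) := by rw [h]
    _ = ‖w‖ * (Complex.exp (-2 * Complex.arg w * Complex.I) *
          Complex.exp (Complex.arg w * Complex.I)) := by ring
    _ = ‖w‖ * Complex.exp (-(Complex.arg w * Complex.I)) := by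
      rw [← Complex.exp_add]; ring_nf
    _ = (starRingEnd ℂ) w := hc.symm

theorem Circle.coe_multiset_prod_map {ι : Type*} (A : Multiset ι) (f : ι → Circle) :
    (((A.map f).prod : Circle) : ℂ) = (A.map fun a => (f a : ℂ)).prod := by
  induction A using Multiset.induction with
  | empty => simp
  | cons a A ih => simp [ih]

/-- The Blaschke factor with zero `a`, normalized at `1`, as a self-map of the circle. -/
noncomputable def blaschkeFactor (a : ℂ) (z : Circle) : Circle :=
  z * Circle.exp (2 * Real.pi * blaschkeArg a z)

/-- With w = 1 - ā z, the exponential contributes w̄/w up to the normalization at 1, and z w̄ = z -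
a on the circle. -/
theorem coe_blaschkeFactor {a : ℂ} (ha : ‖a‖ < 1) (z : Circle) :
    (blaschkeFactor a z : ℂ) = (z - a) / (1 - (starRingEnd ℂ) a * z) *
      ((1 - (starRingEnd ℂ) a) / (1 - a)) := by
  have h1 : 1 - (starRingEnd ℂ) a * z ≠ 0 :=
    Complex.slitPlane_ne_zero (one_sub_conj_mul_mem_slitPlane ha (Circle.norm_coe z).le)
  have h2 : 1 - (starRingEnd ℂ) a ≠ 0 := by
    simpa using Complex.slitPlane_ne_zero
      (one_sub_conj_mul_mem_slitPlane (z := 1) ha norm_one.le)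
  have h3 : 1 - a ≠ 0 := by
    intro h
    apply h2
    simpa only [map_sub, map_one, map_zero] using congrArg (starRingEnd ℂ) h
  have hz : (starRingEnd ℂ) (z : ℂ) = (z : ℂ)⁻¹ := by
    rw [← Circle.coe_inv_eq_conj, Circle.coe_inv]
  have hz0 := Circle.coe_ne_zero z
  have e : ((2 * Real.pi * blaschkeArg a z : ℝ) : ℂ) * Complex.I =
      -2 * Complex.arg (1 - (starRingEnd ℂ) a * z) * Complex.I -
        -2 * Complex.arg (1 - (starRingEnd ℂ) a) * Complex.I := by
    have hpi : (Real.pi : ℂ) ≠ 0 := by simp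
    rw [blaschkeArg]
    push_cast
    field_simp
    ring
  rw [blaschkeFactor, Circle.coe_mul, Circle.coe_exp, e, Complex.exp_sub,
    Complex.exp_neg_two_mul_arg h1, Complex.exp_neg_two_mul_arg h2]
  simp only [map_sub, map_mul, map_one, Complex.conj_conj, hz]
  field_simp

/-- The inverse Cayley transform, from the unit disc to the lower half-plane. -/
noncomputable def cayleyInv (a : ℂ) : ℂ := Complex.I * (a + 1) / (a - 1)

/-- The Cayley transform, from the lower half-plane to the unit disc. -/
noncomputable def cayley (c : ℂ) : ℂ := (c + Complex.I) / (c - Complex.I)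

theorem sub_one_ne_zero_of_norm_lt {a : ℂ} (ha : ‖a‖ < 1) : a - 1 ≠ 0 := by
  rw [sub_ne_zero]
  rintro rfl
  simp at ha

theorem cayleyInv_im_neg {a : ℂ} (ha : ‖a‖ < 1) : (cayleyInv a).im < 0 := by
  have h0 := sub_one_ne_zero_of_norm_lt ha
  have h1 : Complex.normSq a < 1 := by
    rw [Complex.normSq_eq_norm_sq]
    nlinarith [norm_nonneg a]
  have h2 : (cayleyInv a).im = (Complex.normSq a - 1) / Complex.normSq (a - 1) := by
    rw [cayleyInv, Complex.div_im]
    simp [Complex.normSq_apply]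
    ring
  rw [h2]
  exact div_neg_of_neg_of_pos (by linarith) (Complex.normSq_pos.2 h0)

theorem sub_I_ne_zero_of_im_neg {c : ℂ} (hc : c.im < 0) : c - Complex.I ≠ 0 := by
  rw [sub_ne_zero]
  rintro rfl
  simp at hc
  linarith

theorem norm_cayley_lt {c : ℂ} (hc : c.im < 0) : ‖cayley c‖ < 1 := by
  have h0 := sub_I_ne_zero_of_im_neg hc
  rw [cayley, norm_div, div_lt_one (norm_pos_iff.2 h0), Complex.norm_def, Complex.norm_def]
  refine Real.sqrt_lt_sqrt (Complex.normSq_nonneg _) ?_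
  simp [Complex.normSq_apply]
  nlinarith

theorem cayleyInv_cayley {c : ℂ} (hc : c.im < 0) : cayleyInv (cayley c) = c := by
  have h0 := sub_I_ne_zero_of_im_neg hc
  have h1 : cayley c - 1 = 2 * Complex.I / (c - Complex.I) := by
    rw [cayley]; field_simp; ring
  have h2 : cayley c + 1 = 2 * c / (c - Complex.I) := by
    rw [cayley]; field_simp; ring
  rw [cayleyInv, h1, h2]
  have := Complex.I_ne_zero
  field_simp

theorem cayleyInv_injOn {a b : ℂ} (ha : ‖a‖ < 1) (hb : ‖b‖ < 1)
    (h : cayleyInv a = cayleyInv b) : a = b := by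
  have h0 := sub_one_ne_zero_of_norm_lt ha
  have h1 := sub_one_ne_zero_of_norm_lt hb
  rw [cayleyInv, cayleyInv, div_eq_div_iff h0 h1] at h
  have hI : (2 * Complex.I) ≠ 0 := by simp
  refine mul_left_cancel₀ hI ?_
  linear_combination -h

theorem ofReal_sub_ne_zero_of_im_ne_zero {c : ℂ} (hc : c.im ≠ 0) (x : ℝ) : (x : ℂ) - c ≠ 0 := by
  rw [sub_ne_zero]
  rintro rfl
  simp at hc

-- No unimodular constant appears because both sides are normalized to 1 at x = ∞.
open RP1 in
theorem blaschkeFactor_affine {a : ℂ} (ha : ‖a‖ < 1) (x : ℝ) :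
    (blaschkeFactor a (toCircle (affine x)) : ℂ) =
      (x - cayleyInv a) / (x - (starRingEnd ℂ) (cayleyInv a)) := by
  have h0 := sub_one_ne_zero_of_norm_lt ha
  have h0' : 1 - a ≠ 0 := by rwa [← neg_ne_zero, neg_sub]
  have h1 : (starRingEnd ℂ) a - 1 ≠ 0 := sub_one_ne_zero_of_norm_lt (by rwa [RCLike.norm_conj])
  have h2 : (x : ℂ) - Complex.I ≠ 0 := ofReal_sub_ne_zero_of_im_ne_zero (by simp) x
  have h3 : (x : ℂ) - (starRingEnd ℂ) (cayleyInv a) ≠ 0 :=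
    ofReal_sub_ne_zero_of_im_ne_zero (by simpa using (cayleyInv_im_neg ha).ne) x
  have h4 := Complex.slitPlane_ne_zero (one_sub_conj_mul_mem_slitPlane ha
    (Circle.norm_coe (toCircle (affine x))).le)
  rw [coe_blaschkeFactor ha, div_mul_div_comm, div_eq_div_iff (mul_ne_zero h4 h0') h3,
    coe_toCircle_affine]
  simp only [cayleyInv, map_div₀, map_mul, map_add, map_sub, map_one, Complex.conj_I]
  field_simp
  ring

theorem prod_blaschkeFactor (A : Multiset ℂ) (z : Circle) :
    (A.map fun a => blaschkeFactor a z).prod =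
      z ^ A.card * Circle.exp (2 * Real.pi * (A.map fun a => blaschkeArg a z).sum) := by
  induction A using Multiset.induction with
  | empty => simp
  | cons a A ih =>
    rw [Multiset.map_cons, Multiset.prod_cons, ih, Multiset.map_cons, Multiset.sum_cons, mul_add,
      Circle.exp_add, blaschkeFactor, Multiset.card_cons, pow_succ]
    exact mul_mul_mul_comm .. |>.trans (by rw [mul_comm z])

/-- The summand 1/4 in the angle becomes the factor exp(iπ/2) = i, the image of the basepoint. -/
theorem zpow_mul_exp_blaschkeSum (A B : Multiset ℂ) (z : Circle) :
    z ^ ((A.card : ℤ) - B.card) * Circle.exp (2 * Real.pi * blaschkeSum A B z) =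
      Circle.exp (Real.pi / 2) * ((A.map fun a => blaschkeFactor a z).prod *
        ((B.map fun b => blaschkeFactor b z).prod)⁻¹) := by
  have h : 2 * Real.pi * (1 / 4) = Real.pi / 2 := by ring
  rw [prod_blaschkeFactor, prod_blaschkeFactor, blaschkeSum, mul_sub, mul_add, Circle.exp_sub,
    Circle.exp_add, h, zpow_sub, zpow_natCast, zpow_natCast, mul_inv, div_eq_mul_inv]
  ac_rfl

/-- The roots in the half-planes corresponding to the zeros `A` and `B` in the disc. -/
noncomputable def rootsOfZeros (A B : Multiset ℂ) : Multiset ℂ :=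
  A.map cayleyInv + B.map fun b => (starRingEnd ℂ) (cayleyInv b)

-- Inverting a Blaschke factor exchanges its root with the conjugate, so `B` contributes roots in
-- the upper half-plane.
open RP1 in
theorem coe_zpow_mul_exp_blaschkeSum_affine {A B : Multiset ℂ} (hA : ∀ a ∈ A, ‖a‖ < 1)
    (hB : ∀ b ∈ B, ‖b‖ < 1) (x : ℝ) :
    ((toCircle (affine x) ^ ((A.card : ℤ) - B.card) *
      Circle.exp (2 * Real.pi * blaschkeSum A B (toCircle (affine x))) : Circle) : ℂ) =
      Complex.I *
        ((rootsOfZeros A B).map fun c => ((x : ℂ) - c) / (x - (starRingEnd ℂ) c)).prod := by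
  rw [zpow_mul_exp_blaschkeSum, Circle.coe_mul, Circle.coe_mul, Circle.coe_inv, rootsOfZeros,
    Multiset.map_add, Multiset.prod_add, Multiset.map_map, Multiset.map_map]
  congr 1
  · rw [Circle.coe_exp]
    push_cast
    exact Complex.exp_pi_div_two_mul_I
  · congr 1
    · rw [Circle.coe_multiset_prod_map]
      refine congrArg _ (Multiset.map_congr rfl fun a ha => ?_)
      exact blaschkeFactor_affine (hA a ha) x
    · rw [Circle.coe_multiset_prod_map, ← Multiset.prod_map_inv']
      rw [Multiset.map_map]
      refine congrArg _ (Multiset.map_congr rfl fun a ha => ?_)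
      simp only [Function.comp_apply]
      rw [blaschkeFactor_affine (hB a ha) x, inv_div, Complex.conj_conj]

/-! ### Pairs of real polynomials as one complex polynomial -/

/-- The complex polynomial `p + iq`. -/
noncomputable def complexify (p q : ℝ[X]) : ℂ[X] :=
  p.map Complex.ofRealHom + Polynomial.C Complex.I * q.map Complex.ofRealHom

theorem coeff_complexify (p q : ℝ[X]) (i : ℕ) :
    (complexify p q).coeff i = p.coeff i + Complex.I * q.coeff i := by
  simp [complexify]

theorem eval_complexify (p q : ℝ[X]) (c : ℂ) :
    (complexify p q).eval c = Polynomial.aeval c p + Complex.I * Polynomial.aeval c q := by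
  simp [complexify, Polynomial.eval_map, Polynomial.aeval_def]
  rfl

theorem eval_complexify_conj (p q : ℝ[X]) (c : ℂ) :
    (starRingEnd ℂ) ((complexify p q).eval ((starRingEnd ℂ) c)) =
      Polynomial.aeval c p - Complex.I * Polynomial.aeval c q := by
  rw [eval_complexify, Polynomial.aeval_conj, Polynomial.aeval_conj]
  simp [sub_eq_add_neg]

/-- Conjugating the value at c̄ gives p(c) - i q(c), which together with p(c) + i q(c) determines
p(c) and q(c). -/
theorem eval_complexify_eq_zero_and (p q : ℝ[X]) (c : ℂ) :
    ((complexify p q).eval c = 0 ∧ (complexify p q).eval ((starRingEnd ℂ) c) = 0) ↔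
      (Polynomial.aeval c p = 0 ∧ Polynomial.aeval c q = 0) := by
  have h := eval_complexify_conj p q c
  constructor
  · rintro ⟨h1, h2⟩
    rw [h2, map_zero] at h
    rw [eval_complexify] at h1
    constructor
    · linear_combination h1 / 2 - h / 2
    · have := Complex.I_ne_zero
      refine mul_left_cancel₀ this ?_
      linear_combination h1 / 2 + h / 2
  · rintro ⟨h1, h2⟩
    rw [eval_complexify, h1, h2]
    rw [h1, h2] at h
    simpa using h

theorem exists_complexify_eq (H : ℂ[X]) : ∃ p q, complexify p q = H := by
  induction H using Polynomial.induction_on' with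
  | add H H' h h' =>
    obtain ⟨p, q, rfl⟩ := h
    obtain ⟨p', q', rfl⟩ := h'
    refine ⟨p + p', q + q', ?_⟩
    simp only [complexify, Polynomial.map_add]
    ring
  | monomial n c =>
    refine ⟨Polynomial.monomial n c.re, Polynomial.monomial n c.im, ?_⟩
    rw [complexify, Polynomial.map_monomial, Polynomial.map_monomial, Polynomial.C_mul_monomial,
      ← map_add]
    congr 1
    simp only [Complex.ofRealHom_eq_coe]
    rw [mul_comm, Complex.re_add_im]

/-- The monic complex polynomial with the given roots. -/
noncomputable def ofRoots (s : Multiset ℂ) : ℂ[X] :=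
  (s.map fun c => Polynomial.X - Polynomial.C c).prod

theorem eval_ofRoots_eq_zero_iff (s : Multiset ℂ) (c : ℂ) : (ofRoots s).eval c = 0 ↔ c ∈ s := by
  rw [ofRoots, Polynomial.eval_multiset_prod, Multiset.prod_eq_zero_iff, Multiset.map_map]
  simp [sub_eq_zero]

theorem one_add_I_ne_zero : (1 : ℂ) + Complex.I ≠ 0 := by
  intro h
  simpa using congrArg Complex.im h

theorem one_sub_I_ne_zero : (1 : ℂ) - Complex.I ≠ 0 := by
  intro h
  simpa using congrArg Complex.im h

/-- If `p + iq = (1 + i) ∏ (X - c)`, then `p`, `q` are monic of degree the number of factors. -/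
theorem monic_of_complexify_eq {p q : ℝ[X]} {s : Multiset ℂ}
    (h : complexify p q = Polynomial.C (1 + Complex.I) * ofRoots s) :
    (p.Monic ∧ p.natDegree = s.card) ∧ q.Monic ∧ q.natDegree = s.card := by
  have hm : (ofRoots s).Monic := Polynomial.monic_multiset_prod_of_monic _ _
    fun c _ => Polynomial.monic_X_sub_C c
  have hd : (ofRoots s).natDegree = s.card := by
    rw [ofRoots, Polynomial.natDegree_multiset_prod_X_sub_C_eq_card]
  have hc (i) : (p.coeff i : ℂ) + Complex.I * q.coeff i =
      (1 + Complex.I) * (ofRoots s).coeff i := by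
    rw [← coeff_complexify, h, Polynomial.coeff_C_mul]
  have htop := hc s.card
  rw [← hd, hm.coeff_natDegree, hd] at htop
  have hgt (i) (hi : s.card < i) : p.coeff i = 0 ∧ q.coeff i = 0 := by
    have := hc i
    rw [Polynomial.coeff_eq_zero_of_natDegree_lt (p := ofRoots s) (by rwa [hd])] at this
    exact ⟨by simpa using congrArg Complex.re this, by simpa using congrArg Complex.im this⟩
  have hp1 : p.coeff s.card = 1 := by simpa using congrArg Complex.re htop
  have hq1 : q.coeff s.card = 1 := by simpa using congrArg Complex.im htop
  have key (r : ℝ[X]) (h1 : r.coeff s.card = 1) (h0 : ∀ i, s.card < i → r.coeff i = 0) :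
      r.Monic ∧ r.natDegree = s.card := by
    have hle : r.natDegree ≤ s.card := Polynomial.natDegree_le_iff_coeff_eq_zero.2 h0
    refine ⟨Polynomial.monic_of_natDegree_le_of_coeff_eq_one _ hle h1, le_antisymm hle ?_⟩
    exact Polynomial.le_natDegree_of_ne_zero (by rw [h1]; exact one_ne_zero)
  exact ⟨key p hp1 fun i hi => (hgt i hi).1, key q hq1 fun i hi => (hgt i hi).2⟩

theorem exists_complexify_eq_ofRoots {p q : ℝ[X]} (hp : p.Monic) (hq : q.Monic)
    (hpq : p.natDegree = q.natDegree) :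
    ∃ s : Multiset ℂ, complexify p q = Polynomial.C (1 + Complex.I) * ofRoots s := by
  have hn : (complexify p q).coeff p.natDegree = 1 + Complex.I := by
    rw [coeff_complexify, hp.coeff_natDegree, hpq, hq.coeff_natDegree]
    simp
  have hle : (complexify p q).natDegree ≤ p.natDegree := by
    refine Polynomial.natDegree_le_iff_coeff_eq_zero.2 fun i hi => ?_
    rw [coeff_complexify, Polynomial.coeff_eq_zero_of_natDegree_lt hi,
      Polynomial.coeff_eq_zero_of_natDegree_lt (hpq ▸ hi)]
    simp
  have hlc : (complexify p q).leadingCoeff = 1 + Complex.I := by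
    rw [Polynomial.leadingCoeff, le_antisymm hle (Polynomial.le_natDegree_of_ne_zero
      (by rw [hn]; exact one_add_I_ne_zero)), hn]
  refine ⟨(complexify p q).roots, ?_⟩
  rw [← hlc]
  exact (IsAlgClosed.splits _).eq_prod_roots

/-- At real x the point is p + iq divided by its conjugate, and (1 + i)/(1 - i) = i. -/
theorem coe_toCircle_mk_eval {p q : ℝ[X]} {s : Multiset ℂ}
    (h : complexify p q = Polynomial.C (1 + Complex.I) * ofRoots s) (x : ℝ)
    (hx : (![p.eval x, q.eval x] : Fin 2 → ℝ) ≠ 0) :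
    (RP1.toCircle (Projectivization.mk ℝ ![p.eval x, q.eval x] hx) : ℂ) =
      Complex.I * (s.map fun c => ((x : ℂ) - c) / (x - (starRingEnd ℂ) c)).prod := by
  have hp : Polynomial.aeval (x : ℂ) p = ((p.eval x : ℝ) : ℂ) := by
    exact Polynomial.aeval_algebraMap_apply ℂ x p
  have hq : Polynomial.aeval (x : ℂ) q = ((q.eval x : ℝ) : ℂ) := by
    exact Polynomial.aeval_algebraMap_apply ℂ x q
  have h1 : ((p.eval x : ℝ) : ℂ) + (q.eval x : ℝ) * Complex.I =
      (1 + Complex.I) * (s.map fun c => (x : ℂ) - c).prod := by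
    have := eval_complexify p q x
    rw [h, hp, hq, Polynomial.eval_mul, Polynomial.eval_C, ofRoots,
      Polynomial.eval_multiset_prod, Multiset.map_map] at this
    simp only [Function.comp_def, Polynomial.eval_sub, Polynomial.eval_X, Polynomial.eval_C] at this
    rw [this, mul_comm Complex.I]
  have h2 : ((p.eval x : ℝ) : ℂ) - (q.eval x : ℝ) * Complex.I =
      (1 - Complex.I) * (s.map fun c => (x : ℂ) - (starRingEnd ℂ) c).prod := by
    have := congrArg (starRingEnd ℂ) h1
    simp only [map_add, map_mul, Complex.conj_ofReal, Complex.conj_I, map_one,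
      map_multiset_prod, Multiset.map_map, Function.comp_def, map_sub] at this
    rw [sub_eq_add_neg, ← mul_neg, this, sub_eq_add_neg]
  rw [RP1.toCircle_mk]
  simp only [Matrix.cons_val_zero, Matrix.cons_val_one]
  rw [h1, h2, Multiset.prod_map_div, mul_div_mul_comm]
  congr 1
  rw [div_eq_iff one_sub_I_ne_zero, mul_sub, Complex.I_mul_I]
  ring

theorem vec_eval_ne_zero {p q : ℝ[X]} (h : IsCoprime p q) (x : ℝ) :
    (![p.eval x, q.eval x] : Fin 2 → ℝ) ≠ 0 := by
  intro h0
  have h1 : p.eval x = 0 := by simpa using congrFun h0 0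
  have h2 : q.eval x = 0 := by simpa using congrFun h0 1
  obtain ⟨a, b, hab⟩ := h
  have := congrArg (Polynomial.eval x) hab
  simp [h1, h2] at this

/-- Coprimality of `p` and `q` in terms of the roots of `p + iq`. -/
theorem isCoprime_iff_of_complexify_eq {p q : ℝ[X]} {s : Multiset ℂ}
    (h : complexify p q = Polynomial.C (1 + Complex.I) * ofRoots s) :
    IsCoprime p q ↔ ∀ c ∈ s, (starRingEnd ℂ) c ∉ s := by
  have hmem (c : ℂ) : c ∈ s ↔ (complexify p q).eval c = 0 := by
    rw [h, Polynomial.eval_mul, Polynomial.eval_C, mul_eq_zero, or_iff_right one_add_I_ne_zero,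
      eval_ofRoots_eq_zero_iff]
  refine (Polynomial.isCoprime_iff_aeval_ne_zero_of_isAlgClosed ℝ ℂ p q).trans ?_
  refine forall_congr' fun c => ?_
  rw [← not_and_or, ← eval_complexify_eq_zero_and, ← hmem, ← hmem, not_and]

/-- `A` gives lower roots and `B` upper ones, so a conjugate pair must come from one zero common to
both. -/
theorem notMem_rootsOfZeros_iff {A B : Multiset ℂ} (hA : ∀ a ∈ A, ‖a‖ < 1)
    (hB : ∀ b ∈ B, ‖b‖ < 1) :
    (∀ c ∈ rootsOfZeros A B, (starRingEnd ℂ) c ∉ rootsOfZeros A B) ↔ ∀ a ∈ A, a ∉ B := by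
  simp only [rootsOfZeros, Multiset.mem_add, Multiset.mem_map]
  constructor
  · intro h a ha hb
    exact h _ (Or.inl ⟨a, ha, rfl⟩) (Or.inr ⟨a, hb, rfl⟩)
  · rintro h _ (⟨a, ha, rfl⟩ | ⟨b, hb, rfl⟩) (⟨a', ha', h'⟩ | ⟨b', hb', h'⟩)
    · have h1 := cayleyInv_im_neg (hA a ha)
      have h2 := cayleyInv_im_neg (hA a' ha')
      rw [h', Complex.conj_im] at h2
      linarith
    · rw [(starRingEnd ℂ).injective.eq_iff] at h'
      rw [cayleyInv_injOn (hB b' hb') (hA a ha) h'] at hb'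
      exact h a ha hb'
    · rw [Complex.conj_conj] at h'
      rw [cayleyInv_injOn (hA a' ha') (hB b hb) h'] at ha'
      exact h b ha' hb
    · have h1 := cayleyInv_im_neg (hB b hb)
      have h2 := cayleyInv_im_neg (hB b' hb')
      rw [Complex.conj_conj] at h'
      rw [← h', Complex.conj_im] at h1
      linarith

theorem exists_rootsOfZeros_eq {s : Multiset ℂ} (hs : ∀ c ∈ s, c.im ≠ 0) :
    ∃ A B : Multiset ℂ, (∀ a ∈ A, ‖a‖ < 1) ∧ (∀ b ∈ B, ‖b‖ < 1) ∧ rootsOfZeros A B = s := by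
  have hpos : ∀ c ∈ s.filter fun c => ¬ c.im < 0, ((starRingEnd ℂ) c).im < 0 := by
    intro c hc
    rw [Multiset.mem_filter] at hc
    rw [Complex.conj_im]
    have := (not_lt.1 hc.2).lt_of_ne' (hs c hc.1)
    linarith
  refine ⟨(s.filter fun c => c.im < 0).map cayley,
    (s.filter fun c => ¬ c.im < 0).map fun c => cayley ((starRingEnd ℂ) c), ?_, ?_, ?_⟩
  · intro a ha
    obtain ⟨c, hc, rfl⟩ := Multiset.mem_map.1 ha
    exact norm_cayley_lt (Multiset.mem_filter.1 hc).2
  · intro a ha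
    obtain ⟨c, hc, rfl⟩ := Multiset.mem_map.1 ha
    exact norm_cayley_lt (hpos c hc)
  · rw [rootsOfZeros, Multiset.map_map, Multiset.map_map]
    conv_rhs => rw [← Multiset.filter_add_not (fun c : ℂ => c.im < 0) s]
    congr 1
    · conv_rhs => rw [← Multiset.map_id (s.filter fun c => c.im < 0)]
      exact Multiset.map_congr rfl fun c hc => cayleyInv_cayley (Multiset.mem_filter.1 hc).2
    · conv_rhs => rw [← Multiset.map_id (s.filter fun c => ¬ c.im < 0)]
      refine Multiset.map_congr rfl fun c hc => ?_
      simp only [Function.comp_apply]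
      rw [cayleyInv_cayley (hpos c hc), Complex.conj_conj, id]

theorem card_rootsOfZeros (A B : Multiset ℂ) : (rootsOfZeros A B).card = A.card + B.card := by
  simp [rootsOfZeros]

/-! ### Rational maps and angle functions -/

namespace RP1

/-- The self-map of the projective line of degree `d` with boundary angle function `U`. -/
noncomputable def ofAngle (d : ℤ) (U : C(ClosedDisc, ℝ)) : C(RP1, RP1) :=
  mapHomeo.symm (ofLift d (restrictCircle U))

theorem continuous_ofAngle (d : ℤ) : Continuous (ofAngle d) :=
  mapHomeo.symm.continuous.comp ((continuous_ofLift d).comp continuous_restrictCircle)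

theorem toCircle_ofAngle (d : ℤ) (U : C(ClosedDisc, ℝ)) (y : RP1) :
    toCircle (ofAngle d U y) =
      toCircle y ^ d * Circle.exp (2 * Real.pi * U (toCircle y).toClosedDisc) := by
  rw [ofAngle, ← mapHomeo_apply, Homeomorph.apply_symm_apply]
  rfl

theorem ofAngle_infty (d : ℤ) {U : C(ClosedDisc, ℝ)}
    (hU : U (Circle.toClosedDisc 1) = 1 / 4) : ofAngle d U infty = base := by
  apply toCircle_injective
  rw [toCircle_ofAngle, toCircle_infty, hU, one_zpow, one_mul]
  ext
  rw [toCircle_base, Circle.coe_exp]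
  refine Eq.trans ?_ Complex.exp_pi_div_two_mul_I
  congr 2
  push_cast
  ring

theorem ofAngle_affine {A B : Multiset ℂ} (hA : ∀ a ∈ A, ‖a‖ < 1) (hB : ∀ b ∈ B, ‖b‖ < 1)
    {U : C(ClosedDisc, ℝ)} (hU : ∀ z : ClosedDisc, U z = blaschkeSum A B z) {p q : ℝ[X]}
    (h : complexify p q = Polynomial.C (1 + Complex.I) * ofRoots (rootsOfZeros A B)) (x : ℝ)
    (hx : (![p.eval x, q.eval x] : Fin 2 → ℝ) ≠ 0) :
    ofAngle ((A.card : ℤ) - B.card) U (affine x) =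
      Projectivization.mk ℝ ![p.eval x, q.eval x] hx := by
  apply toCircle_injective
  ext
  rw [coe_toCircle_mk_eval h, ← coe_zpow_mul_exp_blaschkeSum_affine hA hB, toCircle_ofAngle, hU,
    Circle.coe_toClosedDisc]

end RP1

open RP1

theorem mem_realRat_of_angleFunctions {n : ℕ} {d : ℤ} {U : C(ClosedDisc, ℝ)}
    (hU : U ∈ angleFunctions n d) (f : LoopRP1) (hf : f.1 = ofAngle d U) : f ∈ realRat n := by
  obtain ⟨A, B, hA, hB, hAB, rfl, rfl, hUz⟩ := hU
  obtain ⟨p, q, h⟩ := exists_complexify_eq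
    (Polynomial.C (1 + Complex.I) * ofRoots (rootsOfZeros A B))
  obtain ⟨⟨hp, hpn⟩, hq, hqn⟩ := monic_of_complexify_eq h
  have hpq := (isCoprime_iff_of_complexify_eq h).2 ((notMem_rootsOfZeros_iff hA hB).2 hAB)
  rw [card_rootsOfZeros] at hpn hqn
  refine ⟨p, q, hp, hq, hpn, hqn, hpq, fun x => ⟨vec_eval_ne_zero hpq x, ?_⟩⟩
  rw [hf]
  exact ofAngle_affine hA hB hUz h x _

theorem exists_angleFunction_of_mem_realRat {n : ℕ} {f : LoopRP1} (hf : f ∈ realRat n) :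
    ∃ d, ∃ U ∈ angleFunctions n d, f.1 = ofAngle d U := by
  obtain ⟨p, q, hp, hq, hpn, hqn, hpq, hfx⟩ := hf
  obtain ⟨s, h⟩ := exists_complexify_eq_ofRoots hp hq (hpn.trans hqn.symm)
  have hs := (isCoprime_iff_of_complexify_eq h).1 hpq
  -- A real root would be its own conjugate, which coprimality forbids.
  obtain ⟨A, B, hA, hB, rfl⟩ := exists_rootsOfZeros_eq (s := s) fun c hc h0 =>
    hs c hc (by rwa [Complex.conj_eq_iff_im.2 h0])
  have hn := (monic_of_complexify_eq h).1.2
  rw [hpn, card_rootsOfZeros] at hn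
  have hU : (⟨_, continuous_blaschkeSum hA hB⟩ : C(ClosedDisc, ℝ)) ∈
      angleFunctions n ((A.card : ℤ) - B.card) :=
    ⟨A, B, hA, hB, (notMem_rootsOfZeros_iff hA hB).1 hs, hn.symm, rfl, fun z => rfl⟩
  refine ⟨_, _, hU, ?_⟩
  ext1 y
  by_cases hy : y = infty
  · rw [hy, f.2, ofAngle_infty]
    exact apply_one_of_mem_closure_angleFunctions (subset_closure hU)
  · obtain ⟨x, rfl⟩ := exists_affine_of_ne_infty hy
    obtain ⟨hx, hfx⟩ := hfx x
    rw [hfx, ofAngle_affine hA hB (fun z => rfl) h x hx]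

/-! ### Components as fibres of a locally constant function -/

theorem IsLocallyConstant.connectedComponent_eq_fiber {X D : Type*} [TopologicalSpace X]
    {δ : X → D} (hδ : IsLocallyConstant δ)
    (hc : ∀ d, ContractibleSpace {x // δ x = d}) (x : X) :
    connectedComponent x = {y | δ y = δ x} := by
  apply Set.Subset.antisymm
  · intro y hy
    exact hδ.apply_eq_of_isPreconnected isPreconnected_connectedComponent hy mem_connectedComponent
  · have : PreconnectedSpace {y | δ y = δ x} :=
      have := hc (δ x)
      inferInstanceAs (PreconnectedSpace {y // δ y = δ x})
    exact (isPreconnected_iff_preconnectedSpace.2 this).subset_connectedComponent rfl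

/-- The components of a space with a locally constant function all of whose fibres are
contractible are the fibres. -/
theorem IsLocallyConstant.exists_connectedComponents_equiv {X D : Type*} [TopologicalSpace X]
    {δ : X → D} (hδ : IsLocallyConstant δ) (hc : ∀ d, ContractibleSpace {x // δ x = d}) :
    (∃ e : ConnectedComponents X ≃ D, ∀ x, e (ConnectedComponents.mk x) = δ x) ∧
      ∀ x : X, ContractibleSpace (connectedComponent x) := by
  have hcomp := hδ.connectedComponent_eq_fiber hc
  constructor
  · let g : ConnectedComponents X → D := Quotient.lift δ fun x y (h : _ = _) => by
      have : x ∈ connectedComponent y := h ▸ mem_connectedComponent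
      rw [hcomp] at this
      exact this
    refine ⟨Equiv.ofBijective g ⟨?_, fun d => ?_⟩, fun x => rfl⟩
    · intro a b
      obtain ⟨x, rfl⟩ := ConnectedComponents.surjective_coe a
      obtain ⟨y, rfl⟩ := ConnectedComponents.surjective_coe b
      intro (h : δ x = δ y)
      rw [ConnectedComponents.coe_eq_coe, hcomp, hcomp, h]
    · have := hc d
      obtain ⟨x, hx⟩ : Nonempty {x // δ x = d} := inferInstance
      exact ⟨ConnectedComponents.mk x, hx⟩
  · intro x
    rw [hcomp]
    exact hc (δ x)

/-! ### The maps of a fixed degree in the closure -/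

theorem mapHomeo_one (f : LoopRP1) : mapHomeo f.1 1 = toCircle base := by
  rw [← toCircle_infty, mapHomeo_apply, f.2]

theorem ofLift_restrictCircle_one (d : ℤ) {U : C(ClosedDisc, ℝ)}
    (hU : U (Circle.toClosedDisc 1) = 1 / 4) :
    ofLift d (restrictCircle U) 1 = toCircle base := by
  have := mapHomeo_one ⟨ofAngle d U, ofAngle_infty d hU⟩
  exact (congrArg (fun g : C(Circle, Circle) => g 1) (mapHomeo.apply_symm_apply _)).symm.trans this

theorem continuous_mapHomeo_val : Continuous fun f : LoopRP1 => mapHomeo f.1 :=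
  mapHomeo.continuous.comp continuous_subtype_val

theorem exists_dist_ofLift_lt {n : ℕ} {f : LoopRP1} (hf : f ∈ ratClosure n) {ε : ℝ} (hε : 0 < ε) :
    ∃ d, ∃ U ∈ angleFunctions n d, dist (mapHomeo f.1) (ofLift d (restrictCircle U)) < ε := by
  have := map_mem_closure continuous_mapHomeo_val hf (Set.mapsTo_image _ _)
  obtain ⟨_, ⟨g, hg, rfl⟩, h⟩ := Metric.mem_closure_iff.1 this ε hε
  obtain ⟨d, U, hU, hgU⟩ := exists_angleFunction_of_mem_realRat hg
  refine ⟨d, U, hU, ?_⟩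
  simpa only [hgU, ofAngle, Homeomorph.apply_symm_apply] using h

theorem hasDegree_of_dist_ofLift_lt {d : ℤ} {v : C(Circle, ℝ)} {f : C(RP1, RP1)}
    (h : dist (mapHomeo f) (ofLift d v) < 2) : HasDegree f d := by
  obtain ⟨u, hu, -⟩ := exists_eq_ofLift_of_dist_lt h
  rw [← mapHomeo.symm_apply_apply f, hu]
  exact hasDegree_mapHomeo_symm_ofLift d u

/-- Approximants of a map of degree `d` by rational maps have angle functions of degree `d`. -/
theorem exists_angleFunctions_dist_lt {n : ℕ} {d : ℤ} {f : LoopRP1} (hf : f ∈ ratClosure n)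
    (hd : HasDegree f.1 d) {ε : ℝ} (hε : 0 < ε) :
    ∃ U ∈ angleFunctions n d, dist (mapHomeo f.1) (ofLift d (restrictCircle U)) < min ε 2 := by
  -- The bound 2 forces the approximant to have the degree of `f`.
  obtain ⟨e, U, hU, h⟩ := exists_dist_ofLift_lt hf (lt_min hε two_pos)
  obtain rfl := (hasDegree_of_dist_ofLift_lt (h.trans_le (min_le_right _ _))).unique hd
  exact ⟨U, hU, h⟩

/-- A lift of `f` taking the value 1/4 at 1 is a uniform limit of boundary values of angle
functions, since close maps have close normalized lifts; the limit then extends to the disc. -/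
theorem exists_eq_ofAngle {n : ℕ} {d : ℤ} {f : LoopRP1} (hf : f ∈ ratClosure n)
    (hd : HasDegree f.1 d) : ∃ U ∈ closure (angleFunctions n d), f.1 = ofAngle d U := by
  have hone {U : C(ClosedDisc, ℝ)} (hU : U ∈ angleFunctions n d) :=
    apply_one_of_mem_closure_angleFunctions (subset_closure hU)
  obtain ⟨V, hV, h⟩ := exists_angleFunctions_dist_lt hf hd two_pos
  obtain ⟨u, hu, hu1⟩ := exists_eq_ofLift_of_dist_lt (h.trans_le (min_le_right _ _))
  have hu1 : u 1 = 1 / 4 := by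
    rw [hu1 (by rw [mapHomeo_one, ofLift_restrictCircle_one d (hone hV)])]
    exact hone hV
  have hmem : u ∈ closure (restrictCircle '' angleFunctions n d) := by
    rw [Metric.mem_closure_iff]
    intro ε hε
    obtain ⟨U, hU, h⟩ := exists_angleFunctions_dist_lt hf hd hε
    rw [hu, lt_min_iff] at h
    refine ⟨_, ⟨U, hU, rfl⟩, (dist_le_of_dist_ofLift_lt (d := d) ?_ h.2).trans_lt (by linarith)⟩
    exact hu1.trans (hone hU).symm
  obtain ⟨U, hU, rfl⟩ := closure_image_restrictCircle_subset n d hmem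
  exact ⟨U, hU, by rw [ofAngle, ← hu, Homeomorph.symm_apply_apply]⟩

theorem isInducing_ofLift_restrictCircle (n : ℕ) (d : ℤ) :
    Topology.IsInducing fun U : closure (angleFunctions n d) => ofLift d (restrictCircle U) := by
  have hc : Continuous fun U : closure (angleFunctions n d) => ofLift d (restrictCircle U) :=
    (continuous_ofLift d).comp (continuous_restrictCircle.comp continuous_subtype_val)
  rw [Topology.isInducing_iff_nhds]
  intro U
  refine le_antisymm hc.continuousAt.le_comap ?_
  rw [Metric.nhds_basis_ball.ge_iff]
  intro ε hε
  refine ⟨Metric.ball (ofLift d (restrictCircle U)) (min ε 2),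
    Metric.ball_mem_nhds _ (lt_min hε two_pos), fun V hV => ?_⟩
  rw [Set.mem_preimage, Metric.mem_ball, lt_min_iff] at hV
  rw [Metric.mem_ball, ← (isometry_restrictCircle n d).dist_eq]
  refine (dist_le_of_dist_ofLift_lt (d := d) ?_ hV.2).trans_lt (by linarith)
  exact (apply_one_of_mem_closure_angleFunctions V.2).trans
    (apply_one_of_mem_closure_angleFunctions U.2).symm

theorem ofAngle_mem_ratClosure {n : ℕ} {d : ℤ} {U : C(ClosedDisc, ℝ)}
    (hU : U ∈ closure (angleFunctions n d)) :
    (⟨ofAngle d U, ofAngle_infty d (apply_one_of_mem_closure_angleFunctions hU)⟩ : LoopRP1) ∈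
      ratClosure n := by
  have hone (U : C(ClosedDisc, ℝ)) : shrink 1 U (Circle.toClosedDisc 1) = 1 / 4 :=
    (congrArg (· + (1 / 4 : ℝ)) (sub_self _)).trans (zero_add _)
  -- Composing with `shrink 1`, which only adjusts the value at 1, defines a based map for every
  -- `U`; on the closure it changes nothing.
  have hΨ : Continuous fun U : C(ClosedDisc, ℝ) =>
      (⟨ofAngle d (shrink 1 U), ofAngle_infty d (hone U)⟩ : LoopRP1) :=
    Continuous.subtype_mk ((continuous_ofAngle d).comp
      (continuous_shrink.comp (Continuous.prodMk_right 1))) _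
  have h1 {V : C(ClosedDisc, ℝ)} (hV : V ∈ closure (angleFunctions n d)) : shrink 1 V = V :=
    shrink_one (apply_one_of_mem_closure_angleFunctions hV)
  have := map_mem_closure hΨ hU (t := realRat n) fun V hV =>
    mem_realRat_of_angleFunctions hV _ (congrArg (ofAngle d) (h1 (subset_closure hV)))
  rw [ratClosure]
  convert this using 3
  exact (h1 hU).symm

/-- The maps of degree `d` in the closure are parametrized by the limits of angle functions. -/
theorem nonempty_homeomorph_closure_angleFunctions (n : ℕ) (d : ℤ) :
    Nonempty (closure (angleFunctions n d) ≃ₜ {f : ratClosure n // HasDegree f.1.1 d}) := by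
  let Ψ : closure (angleFunctions n d) → {f : ratClosure n // HasDegree f.1.1 d} := fun U =>
    ⟨⟨_, ofAngle_mem_ratClosure U.2⟩, hasDegree_mapHomeo_symm_ofLift d _⟩
  have hΨ : Continuous Ψ := Continuous.subtype_mk (Continuous.subtype_mk (Continuous.subtype_mk
    ((continuous_ofAngle d).comp continuous_subtype_val) _) _) _
  have hg : Continuous fun f : {f : ratClosure n // HasDegree f.1.1 d} => mapHomeo f.1.1.1 :=
    continuous_mapHomeo_val.comp (continuous_subtype_val.comp continuous_subtype_val)
  have hind : Topology.IsInducing Ψ := by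
    refine Topology.IsInducing.of_comp hΨ hg ?_
    convert isInducing_ofLift_restrictCircle n d using 1
    ext1 U
    exact mapHomeo.apply_symm_apply _
  refine ⟨(Topology.IsEmbedding.mk hind hind.injective).toHomeomorphOfSurjective ?_⟩
  rintro ⟨⟨f, hf⟩, hd⟩
  obtain ⟨U, hU, hfU⟩ := exists_eq_ofAngle hf hd
  exact ⟨⟨U, hU⟩, Subtype.ext (Subtype.ext (Subtype.ext hfU.symm))⟩

/-! ### The possible degrees and the main theorem -/

theorem degree_bounds_of_mem_angleFunctions {n : ℕ} {d : ℤ} {U : C(ClosedDisc, ℝ)}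
    (hU : U ∈ angleFunctions n d) : -(n : ℤ) ≤ d ∧ d ≤ n ∧ d ≡ n [ZMOD 2] := by
  obtain ⟨A, B, -, -, -, hn, hd, -⟩ := hU
  unfold Int.ModEq
  omega

theorem card_degrees (n : ℕ) :
    Nat.card {d : ℤ // -(n : ℤ) ≤ d ∧ d ≤ n ∧ d ≡ n [ZMOD 2]} = n + 1 := by
  have e : Fin (n + 1) ≃ {d : ℤ // -(n : ℤ) ≤ d ∧ d ≤ n ∧ d ≡ n [ZMOD 2]} :=
    -- Here k is the number of zeros in `A`: |A| - |B| = 2|A| - n.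
    { toFun := fun k => ⟨2 * k - n, by unfold Int.ModEq; omega⟩
      invFun := fun d => ⟨((d.1 + n) / 2).toNat, by obtain ⟨d, h1, h2, h3⟩ := d; simp only; omega⟩
      left_inv := fun k => by ext; simp
      right_inv := fun d => by
        obtain ⟨d, h1, h2, h3⟩ := d
        have := h3.eq
        ext
        simp only
        omega }
  rw [← Nat.card_congr e, Nat.card_fin]

theorem mainTheorem2 (n : ℕ) :
    Nat.card (ConnectedComponents (ratClosure n)) = n + 1 ∧
    (∃ e : ConnectedComponents (ratClosure n) ≃ {d : ℤ // -(n : ℤ) ≤ d ∧ d ≤ n ∧ d ≡ n [ZMOD 2]},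
      ∀ (f : ratClosure n) (d : ℤ),
        RP1.HasDegree f.1.1 d ↔ ((e (ConnectedComponents.mk f) : ℤ) = d)) ∧
    ∀ f : ratClosure n, ContractibleSpace (connectedComponent f) := by
  have hex (f : ratClosure n) : ∃ d : {d : ℤ // -(n : ℤ) ≤ d ∧ d ≤ n ∧ d ≡ n [ZMOD 2]},
      HasDegree f.1.1 d := by
    obtain ⟨d, U, hU, h⟩ := exists_dist_ofLift_lt f.2 two_pos
    exact ⟨⟨d, degree_bounds_of_mem_angleFunctions hU⟩, hasDegree_of_dist_ofLift_lt h⟩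
  choose δ hδ using hex
  have hiff (f : ratClosure n) (d : ℤ) : HasDegree f.1.1 d ↔ (δ f : ℤ) = d :=
    ⟨fun h => (hδ f).unique h, fun h => h ▸ hδ f⟩
  have hloc : IsLocallyConstant δ := by
    rw [IsLocallyConstant.iff_eventually_eq]
    intro f
    obtain ⟨U, -, hfU⟩ := exists_eq_ofAngle f.2 (hδ f)
    have hc : Continuous fun g : ratClosure n => mapHomeo g.1.1 :=
      continuous_mapHomeo_val.comp continuous_subtype_val
    -- Every map within distance 2 of `f` has the degree of `f`.
    filter_upwards [hc.continuousAt.preimage_mem_nhds (Metric.ball_mem_nhds _ two_pos)] with g hg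
    rw [Set.mem_preimage, Metric.mem_ball, hfU, ofAngle, Homeomorph.apply_symm_apply] at hg
    exact Subtype.ext ((hiff g _).1 (hasDegree_of_dist_ofLift_lt hg))
  have hcontr (d) : ContractibleSpace {f // δ f = d} := by
    obtain ⟨d, h1, h2, h3⟩ := d
    have := contractibleSpace_closure_angleFunctions h1 h2 h3
    obtain ⟨φ⟩ := nonempty_homeomorph_closure_angleFunctions n d
    have := φ.symm.contractibleSpace
    have hp : (fun f : ratClosure n => HasDegree f.1.1 d) = fun f => δ f = ⟨d, h1, h2, h3⟩ := by
      ext f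
      rw [hiff, Subtype.ext_iff]
    rwa [hp] at this
  obtain ⟨⟨e, he⟩, hcomp⟩ := hloc.exists_connectedComponents_equiv hcontr
  refine ⟨?_, ⟨e, fun f d => ?_⟩, hcomp⟩
  · rw [Nat.card_congr e, card_degrees]
  · rw [he, hiff]
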